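/- Let $\sigma_y \ge 0$ and $\Delta > 0$. There are constants $C_1, C_2 > 0$, depending only on $\sigma_y$ and $\Delta$, such that the following holds for all integers $d, L, M \ge 1$ and $D \ge 0$ and all reals $\lambda, \epsilon > 0$, $0 < \delta < 1$. Let $\mathcal X \subset \mathbb R^d$ be a compact set of Euclidean diameter $|\mathcal X| = \Delta$, and let $(x_i, y_i)_{i=1}^M$ be a training set with $x_i \in \mathcal X$, $y_i \in \mathbb R$ and $\frac1M\sum_{i=1}^M y_i^2 = \sigma_y^2$. Consider a circuit encoding each of the $d$ input components by $L$ Pauli gates, with generators $H_{\kappa,\ell} \in \{\frac12\sigma_X, \frac12\sigma_Y, \frac12\sigma_Z\}$, $1\le\kappa\le d$, $1\le\ell\le L$. Its set of distinct frequencies is $\Omega = \Omega_1 \times \dots \times \Omega_d \subset \mathbb R^d$, where $\Omega_\kappa$ is the set of all differences $\Lambda - \Lambda'$ of two numbers that are each a sum of one eigenvalue from each of $H_{\kappa,1},\dots,H_{\kappa,L}$; thus $\Omega = \{-L,\dots,L\}^d$. For a finite family $(\omega_j)_{j\in J}$ of frequencies, let $\phi(z) = |J|^{-1/2}\,(\cos(\omega_j^T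 z), \sin(\omega_j^T z))_{j \in J}$, and call $z \mapsto w^T\phi(z)$ the model trained with regularization $\lambda$ if $w$ is the minimizer over all real vectors $w$ of $$\frac1M \sum_{i=1}^M |w^T\phi(x_i) - y_i|^2 + \lambda \|w\|^2 .$$ Let $f$ be the trained model for the family of all frequencies in $\Omega$ (a Fourier series over $\Omega$ with free coefficients). Let $\tilde f$ be the model trained on the same data with the same $\lambda$ for $D$ frequencies $\omega_1,\dots,\omega_D$ drawn independently and uniformly from $\Omega$. If $$D \ \ge\ \frac{d\,C_1(1+\lambda)^2}{\lambda^4\epsilon^2}\left[\log\big(dL^2|\mathcal X|\big) + \log\frac{C_2(1+\lambda)}{\epsilon\lambda^2} - \log\delta\right],$$ then, with probability at least $1-\delta$, $|f(x) - \tilde f(x)| \le \epsilon$ for all $x \in \mathcal X$. -/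

import Mathlib

open scoped BigOperators

/-! ### The frequency spectrum of a circuit with Pauli encoding -/

/-- A generator of a Pauli rotation `exp (-i x σ / 2)`: half of one of the three Pauli matrices. -/
def IsPauliGenerator (H : Matrix (Fin 2) (Fin 2) ℂ) : Prop :=
  H = (1 / 2 : ℂ) • !![0, 1; 1, 0] ∨
  H = (1 / 2 : ℂ) • !![0, -Complex.I; Complex.I, 0] ∨
  H = (1 / 2 : ℂ) • !![1, 0; 0, -1]

/-- The frequencies of a one-dimensional input encoded by the Hamiltonians `H 0, …, H (L-1)`:
all differences `Λ_i - Λ_j`, where `Λ_i` and `Λ_j` are sums of one eigenvalue of each `H ℓ`. -/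
def encodingFrequencies {L : ℕ} (H : Fin L → Matrix (Fin 2) (Fin 2) ℂ) : Set ℝ :=
  {ω | ∃ a b : Fin L → ℝ,
    (∀ ℓ, a ℓ ∈ spectrum ℝ (H ℓ)) ∧ (∀ ℓ, b ℓ ∈ spectrum ℝ (H ℓ)) ∧
      ω = ∑ ℓ, a ℓ - ∑ ℓ, b ℓ}

/-- The set of distinct frequencies of a `d`-dimensional input, each of whose components `κ` is
encoded by the `L` Hamiltonians `H κ`: the product of the one-dimensional spectra. -/
def encodingSpectrum {d L : ℕ} (H : Fin d → Fin L → Matrix (Fin 2) (Fin 2) ℂ) :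
    Set (EuclideanSpace ℝ (Fin d)) :=
  {ω | ∀ κ, ω κ ∈ encodingFrequencies (H κ)}

theorem spectrum_real_matrix_finite (A : Matrix (Fin 2) (Fin 2) ℂ) : (spectrum ℝ A).Finite := by
  have h : (spectrum ℂ A).Finite := Matrix.finite_spectrum A
  rw [← spectrum.preimage_algebraMap (R := ℝ) ℂ]
  exact h.preimage (RCLike.ofReal_injective (K := ℂ)).injOn

theorem encodingFrequencies_finite {L : ℕ} (H : Fin L → Matrix (Fin 2) (Fin 2) ℂ) :
    (encodingFrequencies H).Finite := by
  have h : {a : Fin L → ℝ | ∀ ℓ, a ℓ ∈ spectrum ℝ (H ℓ)}.Finite :=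
    Set.Finite.pi' fun ℓ => spectrum_real_matrix_finite (H ℓ)
  refine (h.image2 (fun a b : Fin L → ℝ => ∑ ℓ, a ℓ - ∑ ℓ, b ℓ) h).subset ?_
  rintro ω ⟨a, b, ha, hb, rfl⟩
  exact ⟨a, ha, b, hb, rfl⟩

theorem encodingSpectrum_finite {d L : ℕ} (H : Fin d → Fin L → Matrix (Fin 2) (Fin 2) ℂ) :
    (encodingSpectrum H).Finite := by
  have h : {v : Fin d → ℝ | ∀ κ, v κ ∈ encodingFrequencies (H κ)}.Finite :=
    Set.Finite.pi' fun κ => encodingFrequencies_finite (H κ)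
  exact h.preimage (f := fun ω : EuclideanSpace ℝ (Fin d) => (ω : Fin d → ℝ))
    (WithLp.ofLp_injective 2).injOn

/-- The finite set of distinct frequencies. -/
noncomputable def spectrumFinset {d L : ℕ} (H : Fin d → Fin L → Matrix (Fin 2) (Fin 2) ℂ) :
    Finset (EuclideanSpace ℝ (Fin d)) :=
  (encodingSpectrum_finite H).toFinset

/-! ### Trigonometric features and ridge regression -/

/-- The feature vector `(cos (ωᵢᵀ z), sin (ωᵢᵀ z))ᵢ / √N` of a family of `N` frequencies. -/
noncomputable def trigFeature {d : ℕ} {ι : Type*} [Fintype ι]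
    (ω : ι → EuclideanSpace ℝ (Fin d)) (z : EuclideanSpace ℝ (Fin d)) :
    EuclideanSpace ℝ (ι ⊕ ι) :=
  WithLp.toLp 2 (Sum.elim
    (fun i => Real.cos (inner ℝ (ω i) z) / √(Fintype.card ι : ℝ))
    (fun i => Real.sin (inner ℝ (ω i) z) / √(Fintype.card ι : ℝ)))

/-- The regularized least squares loss `(1/M) ∑ᵢ (wᵀ φ(xᵢ) - yᵢ)² + lam ‖w‖²`. -/
noncomputable def ridgeLoss {E ι : Type*} [Fintype ι] {M : ℕ}
    (φ : E → EuclideanSpace ℝ ι) (x : Fin M → E) (y : Fin M → ℝ) (lam : ℝ)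
    (w : EuclideanSpace ℝ ι) : ℝ :=
  (1 / (M : ℝ)) * ∑ i, (inner ℝ w (φ (x i)) - y i) ^ 2 + lam * ‖w‖ ^ 2

/-- `f` is the linear model with features `φ`, trained by ridge regression on the data `(xᵢ, yᵢ)`
with regularization `lam`: `f(z) = wᵀ φ(z)` for a global minimizer `w` of the loss. -/
def IsRidgeModel {E ι : Type*} [Fintype ι] {M : ℕ}
    (φ : E → EuclideanSpace ℝ ι) (x : Fin M → E) (y : Fin M → ℝ) (lam : ℝ) (f : E → ℝ) : Prop :=
  ∃ w : EuclideanSpace ℝ ι,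
    (∀ v, ridgeLoss φ x y lam w ≤ ridgeLoss φ x y lam v) ∧ ∀ z, f z = inner ℝ w (φ z)

/-- For a positive regularization there is exactly one trained model. -/
theorem existsUnique_isRidgeModel {E ι : Type*} [Fintype ι] {M : ℕ}
    (φ : E → EuclideanSpace ℝ ι) (x : Fin M → E) (y : Fin M → ℝ) {lam : ℝ} (hlam : 0 < lam) :
    ∃! f : E → ℝ, IsRidgeModel φ x y lam f := by
  have hcont : Continuous (ridgeLoss φ x y lam) := by
    unfold ridgeLoss; fun_prop
  have hlim : Filter.Tendsto (ridgeLoss φ x y lam) (Filter.cocompact _) Filter.atTop := by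
    have h1 : Filter.Tendsto (fun w : EuclideanSpace ℝ ι => lam * ‖w‖ ^ 2)
        (Filter.cocompact _) Filter.atTop :=
      ((Filter.tendsto_pow_atTop two_ne_zero).comp
        (tendsto_norm_cocompact_atTop (E := EuclideanSpace ℝ ι))).const_mul_atTop hlam
    refine Filter.tendsto_atTop_mono (fun w => ?_) h1
    unfold ridgeLoss
    have : 0 ≤ (1 / (M : ℝ)) * ∑ i, (inner ℝ w (φ (x i)) - y i) ^ 2 := by positivity
    linarith
  obtain ⟨w, hw⟩ := hcont.exists_forall_le hlim
  refine ⟨fun z => inner ℝ w (φ z), ⟨w, hw, fun _ => rfl⟩, ?_⟩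
  rintro g ⟨v, hv, hg⟩
  have hmid := hw ((1 / 2 : ℝ) • (w + v))
  have hvw := hv w
  have hpar := parallelogram_law_with_norm ℝ w v
  have hnorm : ‖(1 / 2 : ℝ) • (w + v)‖ ^ 2 = (1 / 4) * ‖w + v‖ ^ 2 := by
    rw [norm_smul, mul_pow]; norm_num
  have hsum : ∑ i, (inner ℝ ((1 / 2 : ℝ) • (w + v)) (φ (x i)) - y i) ^ 2 ≤
      (1 / 2) * ∑ i, (inner ℝ w (φ (x i)) - y i) ^ 2 +
        (1 / 2) * ∑ i, (inner ℝ v (φ (x i)) - y i) ^ 2 := by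
    rw [Finset.mul_sum, Finset.mul_sum, ← Finset.sum_add_distrib]
    refine Finset.sum_le_sum fun i _ => ?_
    rw [real_inner_smul_left, inner_add_left]
    nlinarith [sq_nonneg ((inner ℝ w (φ (x i)) : ℝ) - inner ℝ v (φ (x i)))]
  have hM : (0 : ℝ) ≤ 1 / (M : ℝ) := by positivity
  have hsum' := mul_le_mul_of_nonneg_left hsum hM
  unfold ridgeLoss at hmid hvw
  rw [hnorm] at hmid
  have hz : ‖w - v‖ ^ 2 ≤ 0 := by
    have : lam * ‖w - v‖ ^ 2 ≤ 0 := by nlinarith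
    by_contra! h
    nlinarith [mul_pos hlam h]
  have : w = v := by
    have h0 : ‖w - v‖ = 0 := by nlinarith [norm_nonneg (w - v)]
    exact sub_eq_zero.mp (norm_eq_zero.mp h0)
  funext z
  rw [hg, this]

/-! ### Sampling -/

/-- The law of `D` frequencies drawn independently and uniformly from the finite set `Ω`. -/
noncomputable def samplingLaw {d : ℕ} (Ω : Finset (EuclideanSpace ℝ (Fin d))) (D : ℕ) :
    MeasureTheory.Measure (Fin D → EuclideanSpace ℝ (Fin d)) :=
  MeasureTheory.Measure.pi fun _ : Fin D =>
    ProbabilityTheory.uniformOn (Ω : Set (EuclideanSpace ℝ (Fin d)))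

/-! Ridge regression sees the features only through their kernel, and the kernels here are averages
of `cos (ωᵀ (a - b))`: over all of `Ω` for `f`, over the sample for the random model. So it suffices
that the two kernels be uniformly close, which splits the proof in two. Stability
(`IsRidgeModel.abs_sub_le`): the dual coefficients solve a linear system whose matrix is at least
`lam * M`, so a kernel perturbation of size `η` moves the prediction by at most `σ * η * (1 + lam) /
lam ^ 2`. This fixes the `η` needed for accuracy `ε`. Concentration
(`samplingLaw_exists_trigKernel_gt_le`): at a fixed difference the sampled kernel is a mean of `D`
independent terms in `[-1, 1]` with the full kernel as expectation, so Hoeffding applies.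
Frequencies have coordinates bounded by `L`, hence both kernels are Lipschitz, and a union bound
over a grid covers all differences of points of `X`. The number of grid points, exponential in `d`,
produces the factor `d` and the logarithm. -/

open MeasureTheory ProbabilityTheory

/-! ### Kernels and the dual form of ridge regression -/

/-- The translation invariant kernel `u ↦ (1/N) ∑ᵢ cos (ωᵢᵀ u)` of a family of `N` frequencies. -/
noncomputable def trigKernel {d : ℕ} {ι : Type*} [Fintype ι]
    (ω : ι → EuclideanSpace ℝ (Fin d)) (u : EuclideanSpace ℝ (Fin d)) : ℝ :=
  (∑ i, Real.cos (inner ℝ (ω i) u)) / (Fintype.card ι : ℝ)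

theorem inner_trigFeature {d : ℕ} {ι : Type*} [Fintype ι]
    (ω : ι → EuclideanSpace ℝ (Fin d)) (a b : EuclideanSpace ℝ (Fin d)) :
    inner ℝ (trigFeature ω a) (trigFeature ω b) = trigKernel ω (a - b) := by
  have hN : √(Fintype.card ι : ℝ) * √(Fintype.card ι : ℝ) = Fintype.card ι :=
    Real.mul_self_sqrt (Nat.cast_nonneg _)
  rw [PiLp.inner_apply, Fintype.sum_sum_type, trigKernel]
  simp only [trigFeature, Sum.elim_inl, Sum.elim_inr, RCLike.inner_apply, conj_trivial, div_mul_div_comm, hN]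
  rw [← Finset.sum_div, ← Finset.sum_div, ← add_div, ← Finset.sum_add_distrib]
  congr 1
  refine Finset.sum_congr rfl fun i _ => ?_
  rw [inner_sub_right, Real.cos_sub]
  ring

/-- The empty family is covered too, since its kernel is `0 / 0 = 0`; this matters when `D = 0`. -/
theorem abs_trigKernel_le_one {d : ℕ} {ι : Type*} [Fintype ι]
    (ω : ι → EuclideanSpace ℝ (Fin d)) (u : EuclideanSpace ℝ (Fin d)) :
    |trigKernel ω u| ≤ 1 := by
  unfold trigKernel
  rw [abs_div, Nat.abs_cast]
  refine div_le_one_of_le₀ ?_ (Nat.cast_nonneg _)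
  calc |∑ i, Real.cos (inner ℝ (ω i) u)| ≤ ∑ i, |Real.cos (inner ℝ (ω i) u)| :=
        Finset.abs_sum_le_sum_abs _ _
    _ ≤ ∑ _i : ι, (1 : ℝ) := Finset.sum_le_sum fun i _ => Real.abs_cos_le_one _
    _ = Fintype.card ι := by simp

theorem abs_trigKernel_sub_le {d : ℕ} {ι : Type*} [Fintype ι]
    (ω : ι → EuclideanSpace ℝ (Fin d)) (u v : EuclideanSpace ℝ (Fin d)) {B : ℝ} (hB : 0 ≤ B)
    (h : ∀ i, |(inner ℝ (ω i) (u - v) : ℝ)| ≤ B) :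
    |trigKernel ω u - trigKernel ω v| ≤ B := by
  unfold trigKernel
  rw [← sub_div, ← Finset.sum_sub_distrib, abs_div, Nat.abs_cast]
  refine div_le_of_le_mul₀ (Nat.cast_nonneg _) hB ?_
  calc |∑ i, (Real.cos (inner ℝ (ω i) u) - Real.cos (inner ℝ (ω i) v))|
      ≤ ∑ i, |Real.cos (inner ℝ (ω i) u) - Real.cos (inner ℝ (ω i) v)| :=
        Finset.abs_sum_le_sum_abs _ _
    _ ≤ ∑ _i : ι, B := Finset.sum_le_sum fun i _ => by
        refine (Real.abs_cos_sub_cos_le _ _).trans ?_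
        rw [← inner_sub_right]
        exact h i
    _ = B * Fintype.card ι := by simp [mul_comm]

/-- The discriminant is `4 * b ^ 2` and must be nonpositive. With `b` a directional derivative of
the loss, this is the first-order condition at a minimizer. -/
theorem eq_zero_of_forall_quadratic_nonneg {b c : ℝ}
    (h : ∀ t : ℝ, 0 ≤ 2 * t * b + t ^ 2 * c) : b = 0 := by
  have h1 : discrim c (2 * b) 0 ≤ 0 := discrim_le_zero fun t => by nlinarith [h t]
  unfold discrim at h1
  nlinarith [sq_nonneg b]

/-- The normal equation satisfied by a minimizer of the ridge loss. -/
theorem ridgeLoss_normal_equation {E ι : Type*} [Fintype ι] {M : ℕ}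
    {φ : E → EuclideanSpace ℝ ι} {x : Fin M → E} {y : Fin M → ℝ} {lam : ℝ}
    {w : EuclideanSpace ℝ ι} (hw : ∀ v, ridgeLoss φ x y lam w ≤ ridgeLoss φ x y lam v)
    (v : EuclideanSpace ℝ ι) :
    (1 / (M : ℝ)) * ∑ i, (inner ℝ w (φ (x i)) - y i) * inner ℝ v (φ (x i))
      + lam * inner ℝ w v = 0 := by
  refine eq_zero_of_forall_quadratic_nonneg
    (c := (1 / (M : ℝ)) * ∑ i, (inner ℝ v (φ (x i)) : ℝ) ^ 2 + lam * ‖v‖ ^ 2) fun t => ?_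
  have h := hw (w + t • v)
  have hn : ‖w + t • v‖ ^ 2 = ‖w‖ ^ 2 + 2 * t * inner ℝ w v + t ^ 2 * ‖v‖ ^ 2 := by
    rw [norm_add_sq_real, real_inner_smul_right, norm_smul, mul_pow, Real.norm_eq_abs, sq_abs]
    ring
  have hs : ∑ i, (inner ℝ (w + t • v) (φ (x i)) - y i) ^ 2
      = ∑ i, (inner ℝ w (φ (x i)) - y i) ^ 2
        + 2 * t * ∑ i, (inner ℝ w (φ (x i)) - y i) * inner ℝ v (φ (x i))
        + t ^ 2 * ∑ i, (inner ℝ v (φ (x i)) : ℝ) ^ 2 := by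
    rw [Finset.mul_sum, Finset.mul_sum, ← Finset.sum_add_distrib, ← Finset.sum_add_distrib]
    refine Finset.sum_congr rfl fun i _ => ?_
    rw [inner_add_left, real_inner_smul_left]
    ring
  unfold ridgeLoss at h
  rw [hn, hs] at h
  linarith

/-- The representer theorem for ridge regression, with the equation for the coefficients. -/
theorem IsRidgeModel.exists_coeff {E ι : Type*} [Fintype ι] {M : ℕ} (hM : 1 ≤ M)
    {φ : E → EuclideanSpace ℝ ι} {x : Fin M → E} {y : Fin M → ℝ} {lam : ℝ} (hlam : 0 < lam)
    {f : E → ℝ} (hf : IsRidgeModel φ x y lam f) :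
    ∃ α : Fin M → ℝ, (∀ z, f z = ∑ i, α i * inner ℝ (φ (x i)) (φ z)) ∧
      ∀ j, lam * M * α j + ∑ i, α i * inner ℝ (φ (x i)) (φ (x j)) = y j := by
  obtain ⟨w, hw, hfw⟩ := hf
  have hM0 : (M : ℝ) ≠ 0 := by positivity
  have key : ∀ z, f z = ∑ i, (y i - f (x i)) / (lam * M) * inner ℝ (φ (x i)) (φ z) := by
    intro z
    have h := ridgeLoss_normal_equation hw (φ z)
    have hsum : ∑ i, (y i - f (x i)) / (lam * M) * inner ℝ (φ (x i)) (φ z)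
        = -(∑ i, (inner ℝ w (φ (x i)) - y i) * inner ℝ (φ z) (φ (x i))) / (lam * M) := by
      rw [← Finset.sum_neg_distrib, Finset.sum_div]
      refine Finset.sum_congr rfl fun i _ => ?_
      rw [hfw, real_inner_comm (φ z) (φ (x i))]
      ring
    rw [hsum, hfw, eq_div_iff (by positivity)]
    field_simp at h
    linarith
  refine ⟨fun i => (y i - f (x i)) / (lam * M), key, fun j => ?_⟩
  rw [← key (x j)]
  field_simp
  ring

theorem sum_sum_mul_inner_nonneg {F : Type*} [NormedAddCommGroup F] [InnerProductSpace ℝ F]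
    {M : ℕ} (β : Fin M → ℝ) (u : Fin M → F) :
    0 ≤ ∑ j, β j * ∑ i, β i * (inner ℝ (u i) (u j) : ℝ) := by
  have h : ∑ j, β j * ∑ i, β i * (inner ℝ (u i) (u j) : ℝ)
      = inner ℝ (∑ i, β i • u i) (∑ j, β j • u j) := by
    rw [inner_sum]
    refine Finset.sum_congr rfl fun j _ => ?_
    rw [real_inner_smul_right, sum_inner]
    simp only [real_inner_smul_left]
  rw [h]
  exact real_inner_self_nonneg

/-- Cauchy–Schwarz; the factor `M` lost here is recovered from the `lam * M` of the dual system, so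
the final bounds do not depend on `M`. -/
theorem sum_abs_le_of_sum_sq_le {M : ℕ} (α : Fin M → ℝ) {s : ℝ} (hs : 0 ≤ s)
    (h : M * ∑ i, α i ^ 2 ≤ s ^ 2) : ∑ i, |α i| ≤ s := by
  refine abs_le_of_sq_le_sq' ?_ hs |>.2
  have := sq_sum_le_card_mul_sum_sq (s := Finset.univ) (f := fun i => |α i|)
  simp only [sq_abs, Finset.card_univ, Fintype.card_fin] at this
  exact this.trans h

/-- A bound for the solution of `(lam * M + K) β = r` with `K` positive semidefinite. -/
theorem mul_sum_sq_le_of_regularized_system {F : Type*} [NormedAddCommGroup F]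
    [InnerProductSpace ℝ F] {M : ℕ} (hM : 1 ≤ M) {lam : ℝ} (hlam : 0 < lam)
    (u : Fin M → F) (β r : Fin M → ℝ)
    (h : ∀ j, lam * M * β j + ∑ i, β i * (inner ℝ (u i) (u j) : ℝ) = r j) :
    (lam * M) ^ 2 * ∑ i, β i ^ 2 ≤ ∑ i, r i ^ 2 := by
  have hM0 : (0 : ℝ) < M := by exact_mod_cast hM
  have h1 : lam * M * ∑ j, β j ^ 2 + ∑ j, β j * ∑ i, β i * (inner ℝ (u i) (u j) : ℝ)
      = ∑ j, β j * r j := by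
    rw [Finset.mul_sum, ← Finset.sum_add_distrib]
    refine Finset.sum_congr rfl fun j _ => ?_
    rw [← h j]
    ring
  -- With `a = lam * M`, positivity of the Gram form gives `a * ∑ β² ≤ ∑ β r`; inserting this into
  -- `0 ≤ ∑ (a β - r)²` leaves `a² ∑ β² ≤ ∑ r²`.
  have h2 := sum_sum_mul_inner_nonneg β u
  have h3 : 0 ≤ ∑ j, (lam * M * β j - r j) ^ 2 := Finset.sum_nonneg fun j _ => sq_nonneg _
  have h4 : ∑ j, (lam * M * β j - r j) ^ 2
      = (lam * M) ^ 2 * ∑ j, β j ^ 2 - 2 * (lam * M) * ∑ j, β j * r j + ∑ j, r j ^ 2 := by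
    rw [Finset.mul_sum, Finset.mul_sum, ← Finset.sum_sub_distrib, ← Finset.sum_add_distrib]
    refine Finset.sum_congr rfl fun j _ => ?_
    ring
  have h5 : 0 < lam * M := by positivity
  have h6 := mul_nonneg h5.le h2
  nlinarith

/-- Stability of ridge regression under a uniform perturbation of the kernel. -/
theorem IsRidgeModel.abs_sub_le {E ι κ : Type*} [Fintype ι] [Fintype κ] {M : ℕ} (hM : 1 ≤ M)
    {φ : E → EuclideanSpace ℝ ι} {ψ : E → EuclideanSpace ℝ κ} {x : Fin M → E} {y : Fin M → ℝ}
    {lam σ η : ℝ} (hlam : 0 < lam) (hσ : 0 ≤ σ) (hη : 0 ≤ η)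
    (hy : σ ^ 2 = (1 / (M : ℝ)) * ∑ i, y i ^ 2) {f g : E → ℝ}
    (hf : IsRidgeModel φ x y lam f) (hg : IsRidgeModel ψ x y lam g) (z : E)
    (hψ : ∀ i, |(inner ℝ (ψ (x i)) (ψ z) : ℝ)| ≤ 1)
    (hx : ∀ i j, |(inner ℝ (φ (x i)) (φ (x j)) : ℝ) - inner ℝ (ψ (x i)) (ψ (x j))| ≤ η)
    (hz : ∀ i, |(inner ℝ (φ (x i)) (φ z) : ℝ) - inner ℝ (ψ (x i)) (ψ z)| ≤ η) :
    |f z - g z| ≤ σ * η * (1 + lam) / lam ^ 2 := by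
  obtain ⟨α, hfα, hα⟩ := hf.exists_coeff hM hlam
  obtain ⟨β, hgβ, hβ⟩ := hg.exists_coeff hM hlam
  have hM0 : (0 : ℝ) < M := by exact_mod_cast hM
  have hy' : ∑ i, y i ^ 2 = M * σ ^ 2 := by rw [hy]; field_simp
  have hα1 : ∑ i, |α i| ≤ σ / lam := by
    refine sum_abs_le_of_sum_sq_le α (by positivity) ?_
    have := mul_sum_sq_le_of_regularized_system hM hlam (fun i => φ (x i)) α y hα
    rw [hy'] at this
    rw [div_pow, le_div_iff₀ (by positivity)]
    nlinarith
  have hr : ∀ j, |∑ i, α i * ((inner ℝ (ψ (x i)) (ψ (x j)) : ℝ)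
      - inner ℝ (φ (x i)) (φ (x j)))| ≤ σ / lam * η := by
    intro j
    calc _ ≤ ∑ i, |α i * ((inner ℝ (ψ (x i)) (ψ (x j)) : ℝ) - inner ℝ (φ (x i)) (φ (x j)))| :=
          Finset.abs_sum_le_sum_abs _ _
      _ ≤ ∑ i, |α i| * η := Finset.sum_le_sum fun i _ => by
          rw [abs_mul, abs_sub_comm]
          exact mul_le_mul_of_nonneg_left (hx i j) (abs_nonneg _)
      _ ≤ σ / lam * η := by
          rw [← Finset.sum_mul]
          exact mul_le_mul_of_nonneg_right hα1 hη
  have hβ1 : ∑ i, |α i - β i| ≤ σ / lam * η / lam := by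
    refine sum_abs_le_of_sum_sq_le _ (by positivity) ?_
    -- Subtracting the two dual systems, `α - β` solves the `ψ`-system with right-hand side `(K_ψ -
    -- K_φ) α`, which is small by `hr`.
    have h := mul_sum_sq_le_of_regularized_system hM hlam (fun i => ψ (x i)) (fun i => α i - β i)
      (fun j => ∑ i, α i * ((inner ℝ (ψ (x i)) (ψ (x j)) : ℝ) - inner ℝ (φ (x i)) (φ (x j))))
      (fun j => by
        have h1 := hα j
        have h2 := hβ j
        simp only [sub_mul, mul_sub, Finset.sum_sub_distrib]
        linarith)
    have h' : ∑ j, (∑ i, α i * ((inner ℝ (ψ (x i)) (ψ (x j)) : ℝ)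
        - inner ℝ (φ (x i)) (φ (x j)))) ^ 2 ≤ M * (σ / lam * η) ^ 2 := by
      calc _ ≤ ∑ _j : Fin M, (σ / lam * η) ^ 2 := Finset.sum_le_sum fun j _ => by
            rw [← sq_abs]
            exact pow_le_pow_left₀ (abs_nonneg _) (hr j) 2
        _ = _ := by simp
    have h'' := h.trans h'
    rw [div_pow, le_div_iff₀ (by positivity)]
    nlinarith
  have hdecomp : f z - g z
      = ∑ i, α i * ((inner ℝ (φ (x i)) (φ z) : ℝ) - inner ℝ (ψ (x i)) (ψ z))
        + ∑ i, (α i - β i) * inner ℝ (ψ (x i)) (ψ z) := by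
    rw [hfα, hgβ, ← Finset.sum_add_distrib, ← Finset.sum_sub_distrib]
    refine Finset.sum_congr rfl fun i _ => ?_
    ring
  have hA : |∑ i, α i * ((inner ℝ (φ (x i)) (φ z) : ℝ) - inner ℝ (ψ (x i)) (ψ z))|
      ≤ σ / lam * η := by
    calc _ ≤ ∑ i, |α i * ((inner ℝ (φ (x i)) (φ z) : ℝ) - inner ℝ (ψ (x i)) (ψ z))| :=
          Finset.abs_sum_le_sum_abs _ _
      _ ≤ ∑ i, |α i| * η := Finset.sum_le_sum fun i _ => by
          rw [abs_mul]
          exact mul_le_mul_of_nonneg_left (hz i) (abs_nonneg _)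
      _ ≤ σ / lam * η := by
          rw [← Finset.sum_mul]
          exact mul_le_mul_of_nonneg_right hα1 hη
  have hB : |∑ i, (α i - β i) * (inner ℝ (ψ (x i)) (ψ z) : ℝ)| ≤ σ / lam * η / lam := by
    calc _ ≤ ∑ i, |(α i - β i) * (inner ℝ (ψ (x i)) (ψ z) : ℝ)| :=
          Finset.abs_sum_le_sum_abs _ _
      _ ≤ ∑ i, |α i - β i| := Finset.sum_le_sum fun i _ => by
          rw [abs_mul]
          exact mul_le_of_le_one_right (abs_nonneg _) (hψ i)
      _ ≤ _ := hβ1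
  rw [hdecomp]
  refine (abs_add_le _ _).trans ((add_le_add hA hB).trans (le_of_eq ?_))
  field_simp
  ring

/-! ### The Pauli spectrum -/

/-- All three generators have trace `0` and determinant `-1/4`, hence the same characteristic
polynomial. -/
theorem IsPauliGenerator.mem_spectrum_iff {H : Matrix (Fin 2) (Fin 2) ℂ} (hH : IsPauliGenerator H)
    (μ : ℝ) : μ ∈ spectrum ℝ H ↔ μ ^ 2 = 1 / 4 := by
  rw [spectrum.mem_iff, Matrix.isUnit_iff_isUnit_det, isUnit_iff_ne_zero, not_not]
  have hdet : (algebraMap ℝ (Matrix (Fin 2) (Fin 2) ℂ) μ - H).det = ((μ ^ 2 - 1 / 4 : ℝ) : ℂ) := by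
    rw [Matrix.det_fin_two, Matrix.algebraMap_eq_diagonal]
    rcases hH with rfl | rfl | rfl <;> simp <;> ring_nf <;> simp <;> ring
  rw [hdet, Complex.ofReal_eq_zero, sub_eq_zero]

theorem abs_le_of_mem_encodingFrequencies {L : ℕ} {H : Fin L → Matrix (Fin 2) (Fin 2) ℂ}
    (hH : ∀ ℓ, IsPauliGenerator (H ℓ)) {ω : ℝ} (hω : ω ∈ encodingFrequencies H) : |ω| ≤ L := by
  obtain ⟨a, b, ha, hb, rfl⟩ := hω
  have hle : ∀ c : ℝ, c ^ 2 = 1 / 4 → |c| ≤ 1 / 2 := fun c hc =>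
    abs_le_of_sq_le_sq (by rw [hc]; norm_num) (by norm_num)
  rw [← Finset.sum_sub_distrib]
  calc |∑ ℓ, (a ℓ - b ℓ)| ≤ ∑ ℓ, |a ℓ - b ℓ| := Finset.abs_sum_le_sum_abs _ _
    _ ≤ ∑ _ℓ : Fin L, (1 : ℝ) := Finset.sum_le_sum fun ℓ _ => by
        have h1 := hle _ (((hH ℓ).mem_spectrum_iff _).1 (ha ℓ))
        have h2 := hle _ (((hH ℓ).mem_spectrum_iff _).1 (hb ℓ))
        linarith [abs_sub (a ℓ) (b ℓ)]
    _ = L := by simp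

theorem spectrumFinset_nonempty {d L : ℕ} {H : Fin d → Fin L → Matrix (Fin 2) (Fin 2) ℂ}
    (hH : ∀ κ ℓ, IsPauliGenerator (H κ ℓ)) : (spectrumFinset H).Nonempty := by
  have h : ∀ κ ℓ, (1 / 2 : ℝ) ∈ spectrum ℝ (H κ ℓ) := fun κ ℓ =>
    ((hH κ ℓ).mem_spectrum_iff _).2 (by norm_num)
  exact ⟨0, (encodingSpectrum_finite H).mem_toFinset.2 fun κ =>
    ⟨fun _ => 1 / 2, fun _ => 1 / 2, h κ, h κ, by simp⟩⟩

theorem abs_inner_le_of_mem_spectrumFinset {d L : ℕ}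
    {H : Fin d → Fin L → Matrix (Fin 2) (Fin 2) ℂ} (hH : ∀ κ ℓ, IsPauliGenerator (H κ ℓ))
    {ω : EuclideanSpace ℝ (Fin d)} (hω : ω ∈ spectrumFinset H)
    {u : EuclideanSpace ℝ (Fin d)} {r : ℝ} (hu : ∀ κ, |u κ| ≤ r) :
    |(inner ℝ ω u : ℝ)| ≤ d * L * r := by
  have hω' : ∀ κ, |ω κ| ≤ L := fun κ =>
    abs_le_of_mem_encodingFrequencies (hH κ) ((encodingSpectrum_finite H).mem_toFinset.1 hω κ)
  rw [PiLp.inner_apply]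
  calc |∑ κ, (inner ℝ (ω κ) (u κ) : ℝ)| ≤ ∑ κ, |(inner ℝ (ω κ) (u κ) : ℝ)| :=
        Finset.abs_sum_le_sum_abs _ _
    _ ≤ ∑ _κ : Fin d, L * r := Finset.sum_le_sum fun κ _ => by
        rw [RCLike.inner_apply, conj_trivial, abs_mul, mul_comm]
        exact mul_le_mul (hω' κ) (hu κ) (abs_nonneg _) (Nat.cast_nonneg _)
    _ = d * L * r := by simp [mul_assoc]

/-! ### Concentration of the sampled kernel -/

theorem integral_uniformOn_finset {α : Type*} [MeasurableSpace α] [MeasurableSingletonClass α]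
    (s : Finset α) (f : α → ℝ) :
    ∫ a, f a ∂(uniformOn (s : Set α)) = (∑ a ∈ s, f a) / (s.card : ℝ) := by
  have hint : IntegrableOn f (s : Set α) Measure.count := by
    rw [← Set.biUnion_of_singleton (s : Set α), integrableOn_finite_biUnion s.finite_toSet]
    exact fun a _ => integrableOn_singleton (hx := by simp)
  rw [uniformOn, ProbabilityTheory.cond, integral_smul_measure, setIntegral_finset s hint]
  simp [div_eq_inv_mul, measureReal_def]

/-- This identifies the full kernel as the expectation around which the sampled kernel concentrates.
-/
theorem trigKernel_coe_finset {d : ℕ} (Ω : Finset (EuclideanSpace ℝ (Fin d)))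
    (u : EuclideanSpace ℝ (Fin d)) :
    trigKernel (fun ω : Ω => (ω : EuclideanSpace ℝ (Fin d))) u
      = ∫ ω, Real.cos (inner ℝ ω u) ∂(uniformOn (Ω : Set (EuclideanSpace ℝ (Fin d)))) := by
  rw [integral_uniformOn_finset, trigKernel, Fintype.card_coe]
  congr 1
  exact Finset.sum_coe_sort Ω fun ω => Real.cos (inner ℝ ω u)

/-- Hoeffding's inequality for bounded functions of independent samples, two-sided. -/
theorem measureReal_pi_abs_sum_sub_ge_le {α : Type*} [MeasurableSpace α] (μ : Measure α)
    [IsProbabilityMeasure μ] (D : ℕ) {g : α → ℝ} (hg : Measurable g) (hg1 : ∀ a, |g a| ≤ 1)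
    {t : ℝ} (ht : 0 ≤ t) :
    (Measure.pi fun _ : Fin D => μ).real {ω | t ≤ |∑ j, (g (ω j) - ∫ a, g a ∂μ)|}
      ≤ 2 * Real.exp (-t ^ 2 / (2 * D)) := by
  set P := Measure.pi fun _ : Fin D => μ
  set m := ∫ a, g a ∂μ
  -- Hoeffding's lemma: the variance proxy is the squared half-length of `[-1, 1]`.
  have hsub : HasSubgaussianMGF (fun a => g a - m) 1 μ := by
    have h := hasSubgaussianMGF_of_mem_Icc (μ := μ) (X := g) (a := -1) (b := 1) hg.aemeasurable
      (Filter.Eventually.of_forall fun a => abs_le.1 (hg1 a))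
    have h1 : (‖(1 : ℝ) - -1‖₊ / 2) ^ 2 = 1 := by
      rw [show (1 : ℝ) - -1 = 2 by norm_num]
      simp
    rwa [h1] at h
  have htail : ∀ h : α → ℝ, Measurable h → HasSubgaussianMGF h 1 μ →
      P.real {ω | t ≤ ∑ j, h (ω j)} ≤ Real.exp (-t ^ 2 / (2 * D)) := by
    intro h hh hs
    have hind : iIndepFun (fun (j : Fin D) (ω : Fin D → α) => h (ω j)) P :=
      iIndepFun_pi fun _ => hh.aemeasurable
    have hsj : ∀ j ∈ (Finset.univ : Finset (Fin D)),
        HasSubgaussianMGF (fun ω : Fin D → α => h (ω j)) ((fun _ => 1 : Fin D → NNReal) j) P := by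
      intro j _
      refine HasSubgaussianMGF.of_map (mΩ := inferInstance) (Y := fun ω : Fin D → α => ω j)
        (X := h) ?_ ?_
      · exact (measurable_pi_apply j).aemeasurable
      · rw [(measurePreserving_eval (fun _ : Fin D => μ) j).map_eq]
        exact hs
    have := HasSubgaussianMGF.measure_sum_ge_le_of_iIndepFun hind hsj ht
    simpa using this
  have hunion : {ω : Fin D → α | t ≤ |∑ j, (g (ω j) - m)|}
      ⊆ {ω | t ≤ ∑ j, (g (ω j) - m)} ∪ {ω | t ≤ ∑ j, -(g (ω j) - m)} := by
    intro ω hω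
    rcases le_abs.1 (show t ≤ |_| from hω) with h | h
    · exact Or.inl h
    · refine Or.inr ?_
      rw [← Finset.sum_neg_distrib] at h
      exact h
  have hm : Measurable fun a => g a - m := hg.sub_const m
  have h1 := htail _ hm hsub
  have h2 := htail _ hm.neg hsub.neg
  calc _ ≤ P.real _ := measureReal_mono hunion
    _ ≤ _ := measureReal_union_le _ _
    _ ≤ _ := by
      rw [two_mul]
      exact add_le_add h1 h2

theorem measureReal_samplingLaw_trigKernel_ge_le {d : ℕ}
    {Ω : Finset (EuclideanSpace ℝ (Fin d))} (hΩ : Ω.Nonempty) {D : ℕ} (hD : 0 < D)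
    (u : EuclideanSpace ℝ (Fin d)) {t : ℝ} (ht : 0 ≤ t) :
    (samplingLaw Ω D).real {ω | t ≤ |trigKernel ω u
        - trigKernel (fun ω : Ω => (ω : EuclideanSpace ℝ (Fin d))) u|}
      ≤ 2 * Real.exp (-(D * t ^ 2) / 2) := by
  have : IsProbabilityMeasure (uniformOn (Ω : Set (EuclideanSpace ℝ (Fin d)))) :=
    isProbabilityMeasure_uniformOn Ω.finite_toSet hΩ
  have hD0 : (0 : ℝ) < D := by exact_mod_cast hD
  have h := measureReal_pi_abs_sum_sub_ge_le
    (uniformOn (Ω : Set (EuclideanSpace ℝ (Fin d)))) D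
    (g := fun ω => Real.cos (inner ℝ ω u)) (by fun_prop) (fun _ => Real.abs_cos_le_one _)
    (t := D * t) (by positivity)
  rw [← trigKernel_coe_finset] at h
  have hset : {ω : Fin D → EuclideanSpace ℝ (Fin d) | t ≤ |trigKernel ω u
        - trigKernel (fun ω : Ω => (ω : EuclideanSpace ℝ (Fin d))) u|}
      = {ω | D * t ≤ |∑ j, (Real.cos (inner ℝ (ω j) u)
        - trigKernel (fun ω : Ω => (ω : EuclideanSpace ℝ (Fin d))) u)|} := by
    ext ω
    have h1 : ∑ j, (Real.cos (inner ℝ (ω j) u)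
        - trigKernel (fun ω : Ω => (ω : EuclideanSpace ℝ (Fin d))) u)
        = D * (trigKernel ω u - trigKernel (fun ω : Ω => (ω : EuclideanSpace ℝ (Fin d))) u) := by
      rw [Finset.sum_sub_distrib, trigKernel.eq_def ω, Fintype.card_fin]
      simp only [Finset.sum_const, Finset.card_univ, Fintype.card_fin, nsmul_eq_mul]
      field_simp
    simp only [Set.mem_ofPred_eq, h1, abs_mul, Nat.abs_cast]
    exact (mul_le_mul_iff_right₀ hD0).symm
  rw [hset]
  refine h.trans (le_of_eq ?_)
  congr 2
  field_simp

/-- The law lives on the whole Euclidean space, while the Lipschitz bound needs frequencies in `Ω`;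
the exceptional samples are discarded here. -/
theorem samplingLaw_notMem_eq_zero {d : ℕ} {Ω : Finset (EuclideanSpace ℝ (Fin d))}
    (hΩ : Ω.Nonempty) (D : ℕ) : samplingLaw Ω D {ω | ∃ j, ω j ∉ Ω} = 0 := by
  have : IsProbabilityMeasure (uniformOn (Ω : Set (EuclideanSpace ℝ (Fin d)))) :=
    isProbabilityMeasure_uniformOn Ω.finite_toSet hΩ
  rw [Set.ofPred_exists]
  refine measure_iUnion_null fun j => ?_
  have h : uniformOn (Ω : Set (EuclideanSpace ℝ (Fin d))) {ω | ω ∉ Ω} = 0 := by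
    rw [uniformOn_eq_zero_iff Ω.finite_toSet]
    ext ω
    simp
  exact (measurePreserving_eval
    (fun _ : Fin D => uniformOn (Ω : Set (EuclideanSpace ℝ (Fin d)))) j).quasiMeasurePreserving
      |>.preimage_null h

/-- The points of the grid `r • ℤᵈ` with integer coordinates between `-n` and `n`. -/
noncomputable def gridPoint {d : ℕ} (r : ℝ) (p : Fin d → ℤ) : EuclideanSpace ℝ (Fin d) :=
  WithLp.toLp 2 fun κ => r * p κ

theorem exists_gridPoint_near {d n : ℕ} {r R : ℝ} (hr : 0 < r) (hn : R ≤ r * n)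
    {u : EuclideanSpace ℝ (Fin d)} (hu : ‖u‖ ≤ R) :
    ∃ p ∈ Fintype.piFinset (fun _ : Fin d => Finset.Icc (-(n : ℤ)) n),
      ∀ κ, |(u - gridPoint r p) κ| ≤ r := by
  refine ⟨fun κ => ⌊u κ / r⌋, ?_, fun κ => ?_⟩
  · rw [Fintype.mem_piFinset]
    intro κ
    have h1 : |u κ| ≤ r * n := (PiLp.norm_apply_le u κ).trans (hu.trans hn)
    rw [abs_le] at h1
    rw [Finset.mem_Icc]
    constructor
    · rw [Int.le_floor, le_div_iff₀ hr]
      push_cast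
      nlinarith
    · have : ((⌊u κ / r⌋ : ℤ) : ℝ) ≤ n :=
        (Int.floor_le _).trans (by rw [div_le_iff₀ hr]; nlinarith)
      exact_mod_cast this
  · have h1 := Int.floor_le (u κ / r)
    have h2 := Int.lt_floor_add_one (u κ / r)
    rw [le_div_iff₀ hr] at h1
    rw [div_lt_iff₀ hr] at h2
    simp only [PiLp.sub_apply, gridPoint]
    rw [abs_le]
    constructor <;> nlinarith

/-- Uniform convergence of the sampled kernel on a ball, by a union bound over a grid. -/
theorem samplingLaw_exists_trigKernel_gt_le {d L : ℕ} (hd : 1 ≤ d) (hL : 1 ≤ L)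
    {H : Fin d → Fin L → Matrix (Fin 2) (Fin 2) ℂ} (hH : ∀ κ ℓ, IsPauliGenerator (H κ ℓ))
    {D : ℕ} (hD : 0 < D) {R η : ℝ} (hη : 0 < η) {n : ℕ} (hn : 4 * d * L * R ≤ η * n) :
    samplingLaw (spectrumFinset H) D {ω | ∃ u, ‖u‖ ≤ R ∧ η < |trigKernel ω u
        - trigKernel (fun ω : spectrumFinset H => (ω : EuclideanSpace ℝ (Fin d))) u|}
      ≤ ENNReal.ofReal ((2 * n + 1) ^ d * (2 * Real.exp (-(D * η ^ 2) / 8))) := by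
  have hΩ := spectrumFinset_nonempty hH
  have : IsProbabilityMeasure
      (uniformOn (spectrumFinset H : Set (EuclideanSpace ℝ (Fin d)))) :=
    isProbabilityMeasure_uniformOn (spectrumFinset H).finite_toSet hΩ
  have : IsProbabilityMeasure (samplingLaw (spectrumFinset H) D) := by
    unfold samplingLaw; infer_instance
  have hd0 : (0 : ℝ) < d := by exact_mod_cast hd
  have hL0 : (0 : ℝ) < L := by exact_mod_cast hL
  set k := trigKernel (fun ω : spectrumFinset H => (ω : EuclideanSpace ℝ (Fin d)))
  -- With this mesh, passing to the grid point costs `η / 4` for each kernel, leaving a deviation of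
  -- `η / 2` for Hoeffding.
  set r := η / (4 * d * L) with hr_def
  have hr : 0 < r := by positivity
  have hdr : d * L * r = η / 4 := by rw [hr_def]; field_simp
  have hnr : R ≤ r * n := by
    rw [hr_def, div_mul_eq_mul_div, le_div_iff₀ (by positivity)]
    linarith
  set G := Fintype.piFinset (fun _ : Fin d => Finset.Icc (-(n : ℤ)) n)
  set bad : (Fin d → ℤ) → Set (Fin D → EuclideanSpace ℝ (Fin d)) := fun p =>
    {ω | η / 2 ≤ |trigKernel ω (gridPoint r p) - k (gridPoint r p)|}
  have hsub : {ω : Fin D → EuclideanSpace ℝ (Fin d) |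
      ∃ u, ‖u‖ ≤ R ∧ η < |trigKernel ω u - k u|}
      ⊆ {ω | ∃ j, ω j ∉ spectrumFinset H} ∪ ⋃ p ∈ G, bad p := by
    rintro ω ⟨u, hu, hlt⟩
    by_cases hω : ∃ j, ω j ∉ spectrumFinset H
    · exact Or.inl hω
    push Not at hω
    obtain ⟨p, hp, hnear⟩ := exists_gridPoint_near hr hnr hu
    refine Or.inr (Set.mem_biUnion hp ?_)
    have h1 : |trigKernel ω u - trigKernel ω (gridPoint r p)| ≤ η / 4 :=
      abs_trigKernel_sub_le ω _ _ (by positivity) fun i =>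
        hdr ▸ abs_inner_le_of_mem_spectrumFinset hH (hω i) hnear
    have h2 : |k u - k (gridPoint r p)| ≤ η / 4 :=
      abs_trigKernel_sub_le _ _ _ (by positivity) fun i =>
        hdr ▸ abs_inner_le_of_mem_spectrumFinset hH i.2 hnear
    have h3 : |trigKernel ω u - k u| ≤ |trigKernel ω u - trigKernel ω (gridPoint r p)|
        + |trigKernel ω (gridPoint r p) - k (gridPoint r p)| + |k u - k (gridPoint r p)| := by
      rw [abs_sub_comm (k u)]
      have h4 := abs_sub_le (trigKernel ω u) (trigKernel ω (gridPoint r p)) (k u)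
      have h5 := abs_sub_le (trigKernel ω (gridPoint r p)) (k (gridPoint r p)) (k u)
      linarith
    change η / 2 ≤ _
    linarith
  have hcard : (G.card : ℝ) = (2 * n + 1) ^ d := by
    have : G.card = (2 * n + 1) ^ d := by
      rw [Fintype.card_piFinset]
      simp only [Int.card_Icc, Finset.prod_const, Finset.card_univ, Fintype.card_fin]
      congr 1
      omega
    rw [this]
    push_cast
    rfl
  have hbad : ∀ p ∈ G, (samplingLaw (spectrumFinset H) D).real (bad p)
      ≤ 2 * Real.exp (-(D * η ^ 2) / 8) := fun p _ => by
    refine (measureReal_samplingLaw_trigKernel_ge_le hΩ hD (gridPoint r p)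
      (t := η / 2) (by positivity)).trans (le_of_eq ?_)
    congr 2
    ring
  have hsum : samplingLaw (spectrumFinset H) D (⋃ p ∈ G, bad p)
      ≤ ENNReal.ofReal ((2 * n + 1) ^ d * (2 * Real.exp (-(D * η ^ 2) / 8))) := by
    rw [← ofReal_measureReal (measure_ne_top _ _)]
    refine ENNReal.ofReal_le_ofReal ((measureReal_biUnion_finset_le G bad).trans ?_)
    refine (Finset.sum_le_sum hbad).trans (le_of_eq ?_)
    rw [Finset.sum_const, nsmul_eq_mul, hcard]
  refine (measure_mono hsub).trans ((measure_union_le _ _).trans ?_)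
  rw [samplingLaw_notMem_eq_zero hΩ, zero_add]
  exact hsum

/-- The number of samples that makes the union bound at most `δ`. -/
theorem union_bound_le_of_le {d n : ℕ} (hd : 1 ≤ d) {D η B δ : ℝ} (hη : 0 < η) (hδ : 0 < δ)
    (hδ1 : δ < 1) (hB : 2 ≤ B) (hn : 2 * n + 1 ≤ B)
    (hD : 16 * d / η ^ 2 * (Real.log B - Real.log δ) ≤ D) :
    (2 * (n : ℝ) + 1) ^ d * (2 * Real.exp (-(D * η ^ 2) / 8)) ≤ δ := by
  have hd1 : (1 : ℝ) ≤ d := by exact_mod_cast hd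
  have hB0 : 0 < B := by linarith
  have hlogB : 0 ≤ Real.log B := Real.log_nonneg (by linarith)
  have hlogδ : Real.log δ ≤ 0 := Real.log_nonpos hδ.le hδ1.le
  have h1 : (2 * (n : ℝ) + 1) ^ d ≤ Real.exp (d * Real.log B) := by
    rw [Real.exp_nat_mul, Real.exp_log hB0]
    exact pow_le_pow_left₀ (by positivity) hn d
  -- The factor `2` of the two-sided tail is absorbed into a second copy of `B ^ d`, which doubles
  -- the `8` of the exponent to `16`.
  have h2 : (2 : ℝ) ≤ Real.exp (d * Real.log B) := by
    rw [Real.exp_nat_mul, Real.exp_log hB0]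
    exact hB.trans (le_self_pow₀ (by linarith) (by omega))
  have h3 : 2 * d * (Real.log B - Real.log δ) ≤ D * η ^ 2 / 8 := by
    rw [div_mul_eq_mul_div, div_le_iff₀ (by positivity)] at hD
    linarith
  calc (2 * (n : ℝ) + 1) ^ d * (2 * Real.exp (-(D * η ^ 2) / 8))
      ≤ Real.exp (d * Real.log B) * (Real.exp (d * Real.log B)
          * Real.exp (-(D * η ^ 2) / 8)) := by gcongr
    _ = Real.exp (d * Real.log B + (d * Real.log B + -(D * η ^ 2) / 8)) := by
        rw [Real.exp_add, Real.exp_add]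
    _ ≤ Real.exp (Real.log δ) := by
        refine Real.exp_le_exp.2 ?_
        nlinarith
    _ = δ := Real.exp_log hδ

/-! ### Choice of constants and conclusion -/

theorem theorem1
    (σ_y diamX : ℝ) (hσ_y : 0 ≤ σ_y) (hdiamX : 0 < diamX) :
    ∃ C₁ C₂ : ℝ, 0 < C₁ ∧ 0 < C₂ ∧
      ∀ (d L M D : ℕ), 1 ≤ d → 1 ≤ L → 1 ≤ M →
      ∀ (H : Fin d → Fin L → Matrix (Fin 2) (Fin 2) ℂ), (∀ κ ℓ, IsPauliGenerator (H κ ℓ)) →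
      ∀ (X : Set (EuclideanSpace ℝ (Fin d))), IsCompact X → Metric.diam X = diamX →
      ∀ (x : Fin M → EuclideanSpace ℝ (Fin d)) (y : Fin M → ℝ), (∀ i, x i ∈ X) →
        σ_y ^ 2 = (1 / (M : ℝ)) * ∑ i, y i ^ 2 →
      ∀ (lam ε δ : ℝ), 0 < lam → 0 < ε → 0 < δ → δ < 1 →
      ∀ (f : EuclideanSpace ℝ (Fin d) → ℝ)
        (fRFF : (Fin D → EuclideanSpace ℝ (Fin d)) → EuclideanSpace ℝ (Fin d) → ℝ),
        IsRidgeModel (trigFeature fun ω : spectrumFinset H => (ω : EuclideanSpace ℝ (Fin d)))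
          x y lam f →
        (∀ ω, IsRidgeModel (trigFeature ω) x y lam (fRFF ω)) →
        (d : ℝ) * C₁ * (1 + lam) ^ 2 / (lam ^ 4 * ε ^ 2) *
            (Real.log ((d : ℝ) * (L : ℝ) ^ 2 * diamX)
              + Real.log (C₂ * (1 + lam) / (ε * lam ^ 2)) - Real.log δ) ≤ (D : ℝ) →
        ENNReal.ofReal (1 - δ) ≤
          samplingLaw (spectrumFinset H) D {ω | ∀ z ∈ X, |f z - fRFF ω z| ≤ ε} := by
  -- `σ_y + 1` keeps the constants positive when `σ_y = 0`. The `8` pays for twice the grid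
  -- half-width, and `6 / diamX`, after multiplication by `diamX`, for the rounding term `3 ≤ 6 /
  -- η`.
  refine ⟨16 * (σ_y + 1) ^ 2, (σ_y + 1) * (8 + 6 / diamX), by positivity, by positivity, ?_⟩
  intro d L M D hd hL hM H hH X hX hXdiam x y hxX hy lam ε δ hlam hε hδ hδ1 f fRFF hf hfRFF hbound
  have hΩ := spectrumFinset_nonempty hH
  have : IsProbabilityMeasure
      (uniformOn (spectrumFinset H : Set (EuclideanSpace ℝ (Fin d)))) :=
    isProbabilityMeasure_uniformOn (spectrumFinset H).finite_toSet hΩ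
  have : IsProbabilityMeasure (samplingLaw (spectrumFinset H) D) := by
    unfold samplingLaw; infer_instance
  have hd1 : (1 : ℝ) ≤ d := by exact_mod_cast hd
  have hL1 : (1 : ℝ) ≤ L := by exact_mod_cast hL
  set s := σ_y + 1 with hs_def
  have hs : 0 < s := by positivity
  set c := 8 + 6 / diamX with hc_def
  have hc : 0 < c := by positivity
  set k := trigKernel (fun ω : spectrumFinset H => (ω : EuclideanSpace ℝ (Fin d)))
  set η := ε * lam ^ 2 / ((1 + lam) * s) with hη_def
  have hη : 0 < η := by positivity
  have hηε : σ_y * η * (1 + lam) / lam ^ 2 ≤ ε := by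
    have : σ_y * η * (1 + lam) / lam ^ 2 = ε * (σ_y / s) := by
      rw [hη_def]; field_simp
    rw [this]
    exact mul_le_of_le_one_right hε.le (div_le_one_of_le₀ (by linarith) hs.le)
  have hdiff : ∀ a ∈ X, ∀ b ∈ X, ‖a - b‖ ≤ diamX := fun a ha b hb => by
    rw [← dist_eq_norm, ← hXdiam]
    exact Metric.dist_le_diam_of_mem hX.isBounded ha hb
  have hgood : ∀ ω : Fin D → EuclideanSpace ℝ (Fin d),
      (∀ u, ‖u‖ ≤ diamX → |trigKernel ω u - k u| ≤ η) → ∀ z ∈ X, |f z - fRFF ω z| ≤ ε := by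
    intro ω hω z hz
    refine (hf.abs_sub_le hM hlam hσ_y hη.le hy (hfRFF ω) z ?_ ?_ ?_).trans hηε
    · intro i
      rw [inner_trigFeature]
      exact abs_trigKernel_le_one _ _
    · intro i j
      rw [inner_trigFeature, inner_trigFeature, abs_sub_comm]
      exact hω _ (hdiff _ (hxX i) _ (hxX j))
    · intro i
      rw [inner_trigFeature, inner_trigFeature, abs_sub_comm]
      exact hω _ (hdiff _ (hxX i) _ hz)
  -- For `η ≥ 2` the kernels are trivially within `η`, and the bound on `D` is not needed. Otherwise
  -- `η < 2` forces `B ≥ 2`, so the logarithm is positive and `D > 0`.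
  rcases le_or_gt 2 η with hη2 | hη2
  · have huniv : {ω : Fin D → EuclideanSpace ℝ (Fin d) | ∀ z ∈ X, |f z - fRFF ω z| ≤ ε}
        = Set.univ := by
      refine Set.eq_univ_of_forall fun ω => hgood ω fun u _ => ?_
      have h1 := abs_trigKernel_le_one ω u
      have h2 : |k u| ≤ 1 := abs_trigKernel_le_one _ u
      linarith [abs_sub (trigKernel ω u) (k u)]
    rw [huniv, measure_univ]
    exact ENNReal.ofReal_le_one.2 (by linarith)
  set B := d * L ^ 2 * diamX * (c / η) with hB_def
  have hC₁ : (d : ℝ) * (16 * s ^ 2) * (1 + lam) ^ 2 / (lam ^ 4 * ε ^ 2) = 16 * d / η ^ 2 := by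
    rw [hη_def]; field_simp
  have hC₂ : s * c * (1 + lam) / (ε * lam ^ 2) = c / η := by
    rw [hη_def]; field_simp
  rw [hC₁, hC₂, ← Real.log_mul (by positivity) (by positivity), ← hB_def] at hbound
  have hdL : (1 : ℝ) ≤ d * L ^ 2 := one_le_mul_of_one_le_of_one_le hd1 (one_le_pow₀ hL1)
  set n := ⌈4 * d * L * diamX / η⌉₊ with hn_def
  have hn1 : 4 * d * L * diamX ≤ η * n := by
    have := Nat.le_ceil (4 * d * L * diamX / η)
    rw [div_le_iff₀ hη] at this
    linarith
  have hBexp : B = 8 * (d * L ^ 2 * diamX / η) + d * L ^ 2 * (6 / η) := by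
    rw [hB_def, hc_def]; field_simp
  have hBn : 2 * (n : ℝ) + 1 ≤ B := by
    have h1 : (n : ℝ) < 4 * d * L * diamX / η + 1 := Nat.ceil_lt_add_one (by positivity)
    -- The grid needs only one power of `L`; the square in the hypothesis is slack.
    have h2 : 4 * d * L * diamX / η ≤ 4 * (d * L ^ 2 * diamX / η) := by
      rw [mul_div_assoc', div_le_div_iff_of_pos_right hη]
      have : (d : ℝ) * L * diamX ≤ d * L ^ 2 * diamX := by
        gcongr
        exact le_self_pow₀ hL1 two_ne_zero
      linarith
    have h3 : 3 ≤ 6 / η := by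
      rw [le_div_iff₀ hη]; linarith
    have h4 : 6 / η ≤ d * L ^ 2 * (6 / η) := le_mul_of_one_le_left (by positivity) hdL
    rw [hBexp]
    linarith
  have hB2 : 2 ≤ B := by
    have h3 : 3 ≤ 6 / η := by
      rw [le_div_iff₀ hη]; linarith
    have h4 : 6 / η ≤ d * L ^ 2 * (6 / η) := le_mul_of_one_le_left (by positivity) hdL
    have h5 : 0 ≤ d * L ^ 2 * diamX / η := by positivity
    rw [hBexp]
    linarith
  have hD : 0 < D := by
    have h1 : 0 < Real.log B := Real.log_pos (by linarith)
    have h2 : Real.log δ ≤ 0 := Real.log_nonpos hδ.le hδ1.le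
    have h3 : 0 < 16 * d / η ^ 2 * (Real.log B - Real.log δ) :=
      mul_pos (by positivity) (by linarith)
    exact_mod_cast h3.trans_le hbound
  have hbad := (samplingLaw_exists_trigKernel_gt_le hd hL hH hD hη hn1).trans
    (ENNReal.ofReal_le_ofReal (union_bound_le_of_le hd hη hδ hδ1 hB2 hBn hbound))
  -- Covering the whole space and using subadditivity avoids any measurability of the good event.
  have hcover : (Set.univ : Set (Fin D → EuclideanSpace ℝ (Fin d)))
      ⊆ {ω | ∀ z ∈ X, |f z - fRFF ω z| ≤ ε} ∪ {ω | ∃ u, ‖u‖ ≤ diamX ∧ η < |trigKernel ω u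
        - k u|} := by
    intro ω _
    by_cases h : ∃ u, ‖u‖ ≤ diamX ∧ η < |trigKernel ω u - k u|
    · exact Or.inr h
    · push Not at h
      exact Or.inl (hgood ω h)
  have htotal := (measure_mono hcover).trans (measure_union_le (μ := samplingLaw (spectrumFinset H) D) _ _)
  rw [measure_univ] at htotal
  rw [ENNReal.ofReal_sub _ hδ.le, ENNReal.ofReal_one, tsub_le_iff_right]
  exact htotal.trans (add_le_add_right hbad _)
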